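/- Let $k$ be a field of characteristic different from $2$ and $3$. Let $(A,\mathfrak m)$ be a local Artinian Gorenstein $k$-algebra (Gorenstein: the socle $(0:\mathfrak m)$ is one-dimensional over $A/\mathfrak m$) such that the natural map $k\to A/\mathfrak m$ is an isomorphism; the last condition is automatic if $k$ is algebraically closed and $\dim_k A<\infty$. Let $H_A(i)=\dim_k \mathfrak m^i/\mathfrak m^{i+1}$ be the Hilbert function of $A$, let $d=\max\{i : \mathfrak m^i\neq 0\}$ be its socle degree, and let $\operatorname{gr}A=\bigoplus_{i\ge 0}\mathfrak m^i/\mathfrak m^{i+1}$ be its associated graded algebra. With $n=H_A(1)$, the algebra $A$ is called compressed if $$H_A(i)=\min\left(\binom{i+n-1}{i},\binom{d-i+n-1}{d-i}\right)\quad\text{for all } 0\le i\le d$$ (with the convention $\binom{-1}{0}=1$). 1. If $A$ is compressed and $d\le 4$, then $A$ is canonically graded, i.e. $A\simeq\operatorname{gr}A$ as $k$-algebras. 2. If $H_A=(1,n,n,1)$ for some $n$, then $A$ is compressed of socle degree $3$; if $H_A=\left(1,n,\binom{n+1}{2},n,1\right)$ for some $n$, then $A$ is compressed of socle degree $4$.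 In particular, in both cases $A\simeq\operatorname{gr}A$ as $k$-algebras. -/

import Mathlib

/-!
Let `A` be local Artinian Gorenstein of socle degree `d`, and let `φ : A → k` be a functional which
does not vanish on the socle, so that the pairing `(a, b) ↦ φ (a * b)` is perfect. Choose generators
of the maximal ideal and write `π` for the resulting surjection from a polynomial ring onto `A`.
If the Hilbert function is maximal in degrees below `d - 1` and symmetric, then multiplications by
elements of `𝔪 ^ 2`, followed by `φ`, realise all functionals on the forms of degree `d - 2`.
Together with Euler's identity and the first-order Taylor formula this allows one, when `d - 1` is
invertible in `k`, to move the generators by elements of `𝔪 ^ 2` so that `φ ∘ π` vanishes on all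
forms of degree `d - 1`. The relations then have no terms of degree below `d - 1`, and on
polynomials without such terms `φ ∘ π` depends only on the component of degree `d`; so the ideal of
relations is homogeneous, and `A` is canonically graded. A compressed algebra satisfies the
assumption on the Hilbert function as soon as every `i < d - 1` satisfies `2 * i ≤ d`, that is, for
`d ≤ 4`.
-/

open scoped DirectSum

noncomputable section

namespace AssocGr

universe u v

section Construction

variable {A : Type v} [CommRing A] (I : Ideal A)

/-- The `i`-th graded piece `I ^ i / I ^ (i + 1)`. -/
abbrev Piece (i : ℕ) : Type v :=
  ↥(I ^ i) ⧸ Submodule.comap (I ^ i).subtype (I ^ (i + 1))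

/-- The class in `I ^ i / I ^ (i + 1)` of an element of `I ^ i`. -/
def cls (i : ℕ) (a : A) (ha : a ∈ I ^ i) : Piece I i :=
  Submodule.Quotient.mk ⟨a, ha⟩

theorem cls_surj {i : ℕ} (x : Piece I i) : ∃ (a : A) (ha : a ∈ I ^ i), x = cls I i a ha := by
  obtain ⟨⟨a, ha⟩, rfl⟩ := Submodule.Quotient.mk_surjective _ x
  exact ⟨a, ha, rfl⟩

theorem cls_eq_iff {i : ℕ} {a b : A} (ha : a ∈ I ^ i) (hb : b ∈ I ^ i) :
    cls I i a ha = cls I i b hb ↔ a - b ∈ I ^ (i + 1) := by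
  unfold cls
  rw [Submodule.Quotient.eq]
  rfl

theorem cls_add {i : ℕ} {a b : A} (ha : a ∈ I ^ i) (hb : b ∈ I ^ i) :
    cls I i a ha + cls I i b hb = cls I i (a + b) (add_mem ha hb) := rfl

theorem mul_mem_pow {i j : ℕ} {a b : A} (ha : a ∈ I ^ i) (hb : b ∈ I ^ j) :
    a * b ∈ I ^ (i + j) := by
  rw [pow_add]
  exact Ideal.mul_mem_mul ha hb

/-- The multiplication `I ^ i / I ^ (i + 1) × I ^ j / I ^ (j + 1) → I ^ (i + j) / I ^ (i + j + 1)`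
induced by the multiplication of `A`. -/
def pieceMul {i j : ℕ} (x : Piece I i) (y : Piece I j) : Piece I (i + j) :=
  Quotient.liftOn₂' x y
    (fun a b => cls I (i + j) ((a : A) * (b : A)) (mul_mem_pow I a.2 b.2))
    (by
      rintro ⟨a, ha⟩ ⟨b, hb⟩ ⟨a', ha'⟩ ⟨b', hb'⟩ h₁ h₂
      rw [Submodule.quotientRel_def] at h₁ h₂
      have e₁ : a - a' ∈ I ^ (i + 1) := h₁
      have e₂ : b - b' ∈ I ^ (j + 1) := h₂
      refine (cls_eq_iff I _ _).2 ?_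
      have e : a * b - a' * b' = (a - a') * b + a' * (b - b') := by ring
      change a * b - a' * b' ∈ _
      rw [e]
      refine add_mem ?_ ?_
      · have := mul_mem_pow I e₁ hb
        rwa [show i + 1 + j = i + j + 1 by omega] at this
      · have := mul_mem_pow I ha' e₂
        rwa [← add_assoc] at this)

theorem pieceMul_cls {i j : ℕ} {a b : A} (ha : a ∈ I ^ i) (hb : b ∈ I ^ j) :
    pieceMul I (cls I i a ha) (cls I j b hb) = cls I (i + j) (a * b) (mul_mem_pow I ha hb) :=
  rfl

theorem mem_pow_zero (a : A) : a ∈ I ^ 0 := by simp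

theorem mk_cls_eq {i j : ℕ} {a b : A} (ha : a ∈ I ^ i) (hb : b ∈ I ^ j) (hij : i = j)
    (hab : a = b) :
    (GradedMonoid.mk i (cls I i a ha) : GradedMonoid (Piece I)) =
      GradedMonoid.mk j (cls I j b hb) := by
  subst hij; subst hab; rfl

instance gMul : GradedMonoid.GMul (Piece I) where
  mul x y := pieceMul I x y

instance gOne : GradedMonoid.GOne (Piece I) where
  one := cls I 0 1 (mem_pow_zero I 1)

instance gCommRing : DirectSum.GCommRing (Piece I) where
  mul_zero {i j} x := by
    obtain ⟨a, ha, rfl⟩ := cls_surj I x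
    exact (cls_eq_iff I (mul_mem_pow I ha (zero_mem (I ^ j))) (zero_mem _)).2 (by simp)
  zero_mul {i j} y := by
    obtain ⟨b, hb, rfl⟩ := cls_surj I y
    exact (cls_eq_iff I (mul_mem_pow I (zero_mem (I ^ i)) hb) (zero_mem _)).2 (by simp)
  mul_add {i j} x y z := by
    obtain ⟨a, ha, rfl⟩ := cls_surj I x
    obtain ⟨b, hb, rfl⟩ := cls_surj I y
    obtain ⟨c, hc, rfl⟩ := cls_surj I z
    exact (cls_eq_iff I (mul_mem_pow I ha (add_mem hb hc))
      (add_mem (mul_mem_pow I ha hb) (mul_mem_pow I ha hc))).2 (by simp [mul_add])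
  add_mul {i j} x y z := by
    obtain ⟨a, ha, rfl⟩ := cls_surj I x
    obtain ⟨b, hb, rfl⟩ := cls_surj I y
    obtain ⟨c, hc, rfl⟩ := cls_surj I z
    exact (cls_eq_iff I (mul_mem_pow I (add_mem ha hb) hc)
      (add_mem (mul_mem_pow I ha hc) (mul_mem_pow I hb hc))).2 (by simp [add_mul])
  one_mul := by
    rintro ⟨i, x⟩
    obtain ⟨a, ha, rfl⟩ := cls_surj I x
    exact mk_cls_eq I _ _ (zero_add i) (one_mul a)
  mul_one := by
    rintro ⟨i, x⟩
    obtain ⟨a, ha, rfl⟩ := cls_surj I x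
    exact mk_cls_eq I _ _ (add_zero i) (mul_one a)
  mul_assoc := by
    rintro ⟨i, x⟩ ⟨j, y⟩ ⟨l, z⟩
    obtain ⟨a, ha, rfl⟩ := cls_surj I x
    obtain ⟨b, hb, rfl⟩ := cls_surj I y
    obtain ⟨c, hc, rfl⟩ := cls_surj I z
    exact mk_cls_eq I _ _ (add_assoc i j l) (mul_assoc a b c)
  mul_comm := by
    rintro ⟨i, x⟩ ⟨j, y⟩
    obtain ⟨a, ha, rfl⟩ := cls_surj I x
    obtain ⟨b, hb, rfl⟩ := cls_surj I y
    exact mk_cls_eq I _ _ (add_comm i j) (mul_comm a b)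
  natCast n := cls I 0 (n : A) (mem_pow_zero I _)
  natCast_zero := (cls_eq_iff I _ (zero_mem _)).2 (by simp)
  natCast_succ n := (cls_eq_iff I _ (add_mem (mem_pow_zero I _) (mem_pow_zero I _))).2
    (by simp)
  intCast n := cls I 0 (n : A) (mem_pow_zero I _)
  intCast_ofNat n := (cls_eq_iff I _ _).2 (by simp)
  intCast_negSucc_ofNat n := (cls_eq_iff I _ (neg_mem (mem_pow_zero I _))).2 (by simp)

instance gAlgebra (k : Type u) [CommRing k] [Algebra k A] : DirectSum.GAlgebra k (Piece I) where
  toFun :=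
    { toFun := fun c => cls I 0 (algebraMap k A c) (mem_pow_zero I _)
      map_zero' := (cls_eq_iff I _ (zero_mem _)).2 (by simp)
      map_add' := fun c c' =>
        (cls_eq_iff I _ (add_mem (mem_pow_zero I _) (mem_pow_zero I _))).2 (by simp) }
  map_one := (cls_eq_iff I _ _).2 (by simp)
  map_mul c c' := mk_cls_eq I (mem_pow_zero I _)
    (mul_mem_pow I (mem_pow_zero I _) (mem_pow_zero I _)) rfl (map_mul _ c c')
  commutes c := by
    rintro ⟨i, x⟩
    obtain ⟨a, ha, rfl⟩ := cls_surj I x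
    exact mk_cls_eq I (mul_mem_pow I (mem_pow_zero I _) ha)
      (mul_mem_pow I ha (mem_pow_zero I _)) (add_comm 0 i) (mul_comm _ a)
  smul_def c := by
    rintro ⟨i, x⟩
    obtain ⟨a, ha, rfl⟩ := cls_surj I x
    have h : c • a ∈ I ^ i := by
      rw [Algebra.smul_def]
      exact Ideal.mul_mem_left _ _ ha
    exact mk_cls_eq I h (mul_mem_pow I (mem_pow_zero I _) ha) (zero_add i).symm
      (Algebra.smul_def c a)

end Construction

section LocalAlgebras

variable (k : Type u) [Field k] (A : Type v) [CommRing A] [IsLocalRing A] [Algebra k A]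

open IsLocalRing

/-- The associated graded ring `gr A = ⨁ i, 𝔪 ^ i / 𝔪 ^ (i + 1)` of a local ring. -/
abbrev Gr : Type v := ⨁ i, Piece (maximalIdeal A) i

/-- The Hilbert function `H_A i = dim_k (𝔪 ^ i / 𝔪 ^ (i + 1))`. -/
def hilbertFunction (i : ℕ) : ℕ := Module.finrank k (Piece (maximalIdeal A) i)

/-- The socle of a local ring: the elements killed by the maximal ideal. -/
def socle : Ideal A := Module.annihilator A (maximalIdeal A)

/-- An Artinian local ring is Gorenstein if its socle is a simple module, i.e. one-dimensional
over the residue field. -/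
def IsArtinGorenstein : Prop := IsArtinianRing A ∧ IsSimpleModule A (socle A)

/-- `d` is the socle degree of `A`: the largest `i` with `𝔪 ^ i ≠ 0`. -/
def IsSocleDegree (d : ℕ) : Prop := IsGreatest {i : ℕ | maximalIdeal A ^ i ≠ ⊥} d

/-- `A` is compressed of socle degree `d`: with `n = H_A 1` the embedding dimension,
`H_A i = min (dim S_i) (dim S_{d-i})` for `0 ≤ i ≤ d`, where `S` is a power series ring in `n`
variables, so that `dim S_i = binom (i + n - 1) i`, which is `Nat.multichoose n i`
(in particular `dim S_0 = 1` also for `n = 0`). -/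
def IsCompressed (d : ℕ) : Prop :=
  IsSocleDegree A d ∧
    ∀ i ≤ d, hilbertFunction k A i =
      min (Nat.multichoose (hilbertFunction k A 1) i)
        (Nat.multichoose (hilbertFunction k A 1) (d - i))

/-- `A` is canonically graded: isomorphic, as a `k`-algebra, to its associated graded algebra. -/
def IsCanonicallyGraded : Prop := Nonempty (A ≃ₐ[k] Gr A)

end LocalAlgebras

end AssocGr

end

noncomputable section

namespace AssocGr

open MvPolynomial IsLocalRing

section Polynomials

variable {k : Type*} [CommRing k] {σ : Type*} {s : MvPolynomial σ k} {i : ℕ}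

theorem mem_pow_idealOfVars_of_isHomogeneous (hs : s.IsHomogeneous i) :
    s ∈ idealOfVars σ k ^ i :=
  (mem_pow_idealOfVars_iff' _ _).2 fun _ he => hs.coeff_eq_zero he.ne

theorem homogeneousComponent_mem_pow_idealOfVars (hs : s ∈ idealOfVars σ k ^ i) (j : ℕ) :
    homogeneousComponent j s ∈ idealOfVars σ k ^ i := by
  classical
  refine (mem_pow_idealOfVars_iff' _ _).2 fun e he => ?_
  rw [coeff_homogeneousComponent, (mem_pow_idealOfVars_iff' _ _).1 hs e he, ite_self]

theorem sub_homogeneousComponent_mem_pow_idealOfVars (hs : s ∈ idealOfVars σ k ^ i) :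
    s - homogeneousComponent i s ∈ idealOfVars σ k ^ (i + 1) := by
  classical
  refine (mem_pow_idealOfVars_iff' _ _).2 fun e he => ?_
  rw [coeff_sub, coeff_homogeneousComponent]
  obtain h | h := (Nat.lt_succ_iff.1 he).eq_or_lt
  · rw [if_pos h, sub_self]
  · rw [if_neg h.ne, (mem_pow_idealOfVars_iff' _ _).1 hs e h, sub_zero]

theorem homogeneousComponent_eq_zero_of_mem_pow_idealOfVars (hs : s ∈ idealOfVars σ k ^ i)
    {j : ℕ} (hj : j < i) : homogeneousComponent j s = 0 := by
  classical
  ext e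
  rw [coeff_homogeneousComponent, coeff_zero]
  split_ifs with h
  · exact (mem_pow_idealOfVars_iff' _ _).1 hs e (h ▸ hj)
  · rfl

attribute [local instance] MvPolynomial.gradedAlgebra in
theorem homogeneousComponent_add_mul (hs : s.IsHomogeneous i) (t : MvPolynomial σ k) (j : ℕ) :
    homogeneousComponent (i + j) (s * t) = s * homogeneousComponent j t := by
  simp only [← decomposition.decompose'_apply]
  exact DirectSum.coe_decompose_mul_add_of_left_mem (homogeneousSubmodule σ k) hs

theorem isHomogeneous_induction {P : ℕ → MvPolynomial σ k → Prop} (zero : ∀ i, P i 0)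
    (add : ∀ i s t, s.IsHomogeneous i → t.IsHomogeneous i → P i s → P i t → P i (s + t))
    (C : ∀ c, P 0 (C c)) (X_mul : ∀ i j s, s.IsHomogeneous i → P i s → P (i + 1) (X j * s))
    (hs : s.IsHomogeneous i) : P i s := by
  induction i generalizing s with
  | zero =>
    rw [totalDegree_eq_zero_iff_eq_C.1 ((totalDegree_zero_iff_isHomogeneous σ).2 hs)]
    exact C _
  | succ i ih =>
    suffices h : ∀ a ∈ homogeneousSubmodule σ k 1, ∀ b ∈ homogeneousSubmodule σ k i,
        (a * b).IsHomogeneous (i + 1) ∧ P (i + 1) (a * b) by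
      rw [← mem_homogeneousSubmodule, ← homogeneousSubmodule_one_pow, pow_succ',
        homogeneousSubmodule_one_pow] at hs
      refine (Submodule.mul_induction_on (C := fun s => s.IsHomogeneous (i + 1) ∧ P (i + 1) s)
        hs h fun s t hs ht => ?_).2
      exact ⟨hs.1.add ht.1, add _ _ _ hs.1 ht.1 hs.2 ht.2⟩
    intro a ha
    rw [homogeneousSubmodule_one_eq_span_X] at ha
    induction ha using Submodule.span_induction with
    | mem a ha =>
      obtain ⟨j, rfl⟩ := ha
      exact fun b hb => ⟨add_comm 1 i ▸ (isHomogeneous_X k j).mul hb, X_mul i j b hb (ih hb)⟩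
    | zero => exact fun b _ => by simpa only [zero_mul] using ⟨isHomogeneous_zero _ _ _, zero _⟩
    | add a a' _ _ h h' =>
      intro b hb
      rw [add_mul]
      exact ⟨(h b hb).1.add (h' b hb).1, add _ _ _ (h b hb).1 (h' b hb).1 (h b hb).2 (h' b hb).2⟩
    | smul r a _ h =>
      intro b hb
      rw [smul_mul_assoc, ← mul_smul_comm]
      exact h _ (Submodule.smul_mem _ r hb)

instance [Finite σ] : Module.Finite k (homogeneousSubmodule σ k i) :=
  Module.Finite.iff_fg.2 (homogeneousSubmodule_fg σ k i)

theorem finrank_homogeneousSubmodule [Nontrivial k] [Fintype σ] :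
    Module.finrank k (homogeneousSubmodule σ k i) = (Fintype.card σ).multichoose i := by
  classical
  rw [homogeneousSubmodule_eq_finsupp_supported]
  change Module.finrank k (restrictSupport k {d : σ →₀ ℕ | d.degree = i}) = _
  rw [Module.finrank_eq_nat_card_basis (basisRestrictSupport k {d : σ →₀ ℕ | d.degree = i}),
    ← Sym.card_sym_eq_multichoose, ← Nat.card_eq_fintype_card]
  exact Nat.card_congr (Sym.equivNatSum σ i).symm

end Polynomials

section Generators

variable {k : Type*} [CommRing k] {A : Type*} [CommRing A] [Algebra k A] {I : Ideal A}
  {σ : Type*} {x : σ → A} {s : MvPolynomial σ k} {i : ℕ}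

theorem exists_sub_algebraMap_mem (hk : Function.Surjective (algebraMap k (A ⧸ I))) (a : A) :
    ∃ c : k, a - algebraMap k A c ∈ I := by
  obtain ⟨c, hc⟩ := hk (Ideal.Quotient.mk I a)
  exact ⟨c, Ideal.Quotient.eq.1 hc.symm⟩

theorem map_aeval_idealOfVars (x : σ → A) :
    (idealOfVars σ k).map (aeval x) = Ideal.span (Set.range x) := by
  rw [idealOfVars, Ideal.map_span, ← Set.range_comp]
  congr 2
  ext j
  simp only [Function.comp_apply, aeval_X]

theorem aeval_mem_pow (hx : ∀ j, x j ∈ I) (hs : s ∈ idealOfVars σ k ^ i) : aeval x s ∈ I ^ i := by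
  have hle : (idealOfVars σ k).map (aeval x) ≤ I := by
    rw [map_aeval_idealOfVars, Ideal.span_le]
    exact Set.range_subset_iff.2 hx
  refine Ideal.pow_right_mono hle i ?_
  rw [← Ideal.map_pow]
  exact Ideal.mem_map_of_mem _ hs

theorem aeval_mem_pow_of_isHomogeneous (hx : ∀ j, x j ∈ I) (hs : s.IsHomogeneous i) :
    aeval x s ∈ I ^ i :=
  aeval_mem_pow hx (mem_pow_idealOfVars_of_isHomogeneous hs)

theorem mem_of_span_range_eq (hx : Ideal.span (Set.range x) = I) (j : σ) : x j ∈ I :=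
  hx ▸ Ideal.subset_span (Set.mem_range_self j)

theorem exists_isHomogeneous_sub_aeval_mem (hk : Function.Surjective (algebraMap k (A ⧸ I)))
    (hx : Ideal.span (Set.range x) = I) {a : A} (ha : a ∈ I ^ i) :
    ∃ s : MvPolynomial σ k, s.IsHomogeneous i ∧ a - aeval x s ∈ I ^ (i + 1) := by
  have hspan : I ^ i =
      Ideal.span (aeval x '' ((monomial · (1 : k)) '' (Finsupp.degree ⁻¹' {i}))) := by
    rw [← Ideal.map_span, ← pow_idealOfVars_eq_span, Ideal.map_pow, map_aeval_idealOfVars, hx]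
  rw [hspan] at ha
  induction ha using Submodule.span_induction with
  | mem a ha =>
    obtain ⟨_, ⟨e, he, rfl⟩, rfl⟩ := ha
    exact ⟨monomial e 1, isHomogeneous_monomial _ he, by simp only [sub_self, zero_mem]⟩
  | zero => exact ⟨0, isHomogeneous_zero _ _ _, by simp only [map_zero, sub_self, zero_mem]⟩
  | add a b _ _ ha hb =>
    obtain ⟨s, hs, hsa⟩ := ha
    obtain ⟨t, ht, htb⟩ := hb
    exact ⟨s + t, hs.add ht, by simpa only [map_add, add_sub_add_comm] using add_mem hsa htb⟩
  | smul r a ha h =>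
    obtain ⟨s, hs, hsa⟩ := h
    obtain ⟨c, hc⟩ := exists_sub_algebraMap_mem hk r
    refine ⟨C c * s, hs.C_mul c, ?_⟩
    have hsplit : r • a - aeval x (C c * s) =
        (r - algebraMap k A c) * a + algebraMap k A c * (a - aeval x s) := by
      rw [map_mul, algHom_C, smul_eq_mul]
      ring
    rw [hsplit, pow_succ']
    refine add_mem (Ideal.mul_mem_mul hc (hspan ▸ ha)) (Ideal.mul_mem_left _ _ ?_)
    rwa [← pow_succ']

theorem aeval_surjective (hk : Function.Surjective (algebraMap k (A ⧸ I)))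
    (hx : Ideal.span (Set.range x) = I) (hI : IsNilpotent I) :
    Function.Surjective (aeval x : MvPolynomial σ k →ₐ[k] A) := by
  intro a
  have happrox (N : ℕ) : ∃ s : MvPolynomial σ k, a - aeval x s ∈ I ^ N := by
    induction N with
    | zero => exact ⟨0, mem_pow_zero I _⟩
    | succ N ih =>
      obtain ⟨s, hs⟩ := ih
      obtain ⟨t, -, ht⟩ := exists_isHomogeneous_sub_aeval_mem hk hx hs
      exact ⟨s + t, by rwa [map_add, ← sub_sub]⟩
  obtain ⟨N, hN⟩ := hI
  obtain ⟨s, hs⟩ := happrox N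
  rw [hN] at hs
  exact ⟨s, (sub_eq_zero.1 hs).symm⟩

theorem exists_mem_pow_idealOfVars_aeval_eq (hk : Function.Surjective (algebraMap k (A ⧸ I)))
    (hx : Ideal.span (Set.range x) = I) (hI : IsNilpotent I) {a : A} (ha : a ∈ I ^ i) :
    ∃ s ∈ idealOfVars σ k ^ i, aeval x s = a := by
  rw [← hx, ← map_aeval_idealOfVars (k := k), ← Ideal.map_pow] at ha
  exact (Ideal.mem_map_iff_of_surjective _ (aeval_surjective hk hx hI)).1 ha

theorem finite_of_isNilpotent (hk : Function.Surjective (algebraMap k (A ⧸ I)))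
    (hfg : I.FG) (hI : IsNilpotent I) : Module.Finite k A := by
  obtain ⟨n, x, hx⟩ := Submodule.fg_iff_exists_fin_generating_family.1 hfg
  have : Algebra.FiniteType k A := .of_surjective _ (aeval_surjective hk hx hI)
  have : Algebra.IsIntegral k A := ⟨fun a => by
    obtain ⟨c, hc⟩ := exists_sub_algebraMap_mem hk a
    obtain ⟨N, hN⟩ := hI
    have hpow : (a - algebraMap k A c) ^ N = 0 := by
      simpa only [hN, Ideal.zero_eq_bot, Ideal.mem_bot] using Ideal.pow_mem_pow hc N
    have hint : IsIntegral k (a - algebraMap k A c) :=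
      ⟨Polynomial.X ^ N, Polynomial.monic_X_pow N, by simpa using hpow⟩
    simpa only [sub_add_cancel] using hint.add (isIntegral_algebraMap (x := c))⟩
  exact Algebra.IsIntegral.finite

theorem eq_of_le_sup_sq {J : Ideal A} (hI : I ≤ Ideal.jacobson ⊥) (hfg : I.FG) (hJ : J ≤ I)
    (h : I ≤ J ⊔ I ^ 2) : J = I :=
  hJ.antisymm (Submodule.le_of_le_smul_of_le_jacobson_bot hfg hI (by rwa [smul_eq_mul, ← sq]))

theorem span_range_add_eq (hI : I ≤ Ideal.jacobson ⊥) (hfg : I.FG)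
    (hx : Ideal.span (Set.range x) = I) {c : σ → A} (hc : ∀ j, c j ∈ I ^ 2) :
    Ideal.span (Set.range (x + c)) = I := by
  have hmem := mem_of_span_range_eq hx
  refine eq_of_le_sup_sq hI hfg ?_ ?_
  · refine Ideal.span_le.2 (Set.range_subset_iff.2 fun j => ?_)
    exact add_mem (hmem j) (Ideal.pow_le_self two_ne_zero (hc j))
  · conv_lhs => rw [← hx]
    refine Ideal.span_le.2 (Set.range_subset_iff.2 fun j => ?_)
    rw [← add_sub_cancel_right (x j) (c j)]
    exact sub_mem (Ideal.mem_sup_left (Ideal.subset_span ⟨j, rfl⟩)) (Ideal.mem_sup_right (hc j))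

end Generators

section GradedMap

variable {k : Type*} [CommRing k] {A : Type*} [CommRing A] [Algebra k A] {I : Ideal A}
  {σ : Type*} {x : σ → A} {s : MvPolynomial σ k} {i : ℕ}

theorem cls_eq_zero_iff {a : A} (ha : a ∈ I ^ i) : cls I i a ha = 0 ↔ a ∈ I ^ (i + 1) := by
  have := cls_eq_iff I ha (zero_mem (I ^ i))
  rwa [sub_zero] at this

variable (k I) in
/-- The projection `I ^ i → I ^ i / I ^ (i + 1)` as a `k`-linear map. -/
def pieceMk (i : ℕ) : ↥(I ^ i) →ₗ[k] Piece I i :=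
  (Submodule.mkQ (Submodule.comap (I ^ i).subtype (I ^ (i + 1)))).restrictScalars k

variable (I) in
theorem pieceMk_surjective (i : ℕ) : Function.Surjective (pieceMk k I i) := by
  intro y
  obtain ⟨a, ha, rfl⟩ := cls_surj I y
  exact ⟨⟨a, ha⟩, rfl⟩

variable (I) in
theorem pieceMk_eq_zero_iff {i : ℕ} (a : ↥(I ^ i)) : pieceMk k I i a = 0 ↔ (a : A) ∈ I ^ (i + 1) :=
  cls_eq_zero_iff a.2

variable (k) in
/-- The homomorphism from a polynomial ring to the associated graded ring of `I` which sends the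
variables to the degree one classes of given elements of `I`. -/
def toGr (x : σ → A) (hx : ∀ j, x j ∈ I) : MvPolynomial σ k →ₐ[k] ⨁ i, Piece I i :=
  aeval fun j => DirectSum.of (Piece I) 1 (cls I 1 (x j) ((pow_one I).symm ▸ hx j))

theorem toGr_of_isHomogeneous (hx : ∀ j, x j ∈ I) (hs : s.IsHomogeneous i) :
    toGr k x hx s =
      DirectSum.of (Piece I) i (cls I i (aeval x s) (aeval_mem_pow_of_isHomogeneous hx hs)) := by
  have hmem {i} {s : MvPolynomial σ k} (hs : s.IsHomogeneous i) : aeval x s ∈ I ^ i :=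
    aeval_mem_pow_of_isHomogeneous hx hs
  suffices h : ∀ h : aeval x s ∈ I ^ i,
      toGr k x hx s = DirectSum.of (Piece I) i (cls I i (aeval x s) h) from h _
  refine isHomogeneous_induction (P := fun i s => ∀ h : aeval x s ∈ I ^ i,
    toGr k x hx s = DirectSum.of (Piece I) i (cls I i (aeval x s) h)) ?_ ?_ ?_ ?_ hs
  · intro i h
    rw [(cls_eq_zero_iff h).2 (by simp only [map_zero, zero_mem]), map_zero, map_zero]
  · intro i s t hs ht ihs iht h
    rw [map_add, ihs (hmem hs), iht (hmem ht), ← map_add, cls_add]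
    simp only [map_add]
  · intro c h
    rw [algHom_C, DirectSum.algebraMap_apply]
    exact DirectSum.of_eq_of_gradedMonoid_eq (mk_cls_eq I _ _ rfl (algHom_C _ c).symm)
  · intro i j s hs ihs h
    have hj : x j ∈ I ^ 1 := (pow_one I).symm ▸ hx j
    rw [map_mul, ihs (hmem hs), toGr, aeval_X, DirectSum.of_mul_of]
    exact DirectSum.of_eq_of_gradedMonoid_eq (mk_cls_eq I (mul_mem_pow I hj (hmem hs)) h
      (add_comm 1 i) (by rw [map_mul, aeval_X]))

theorem toGr_apply (hx : ∀ j, x j ∈ I) (s : MvPolynomial σ k) (i : ℕ) :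
    toGr k x hx s i = cls I i (aeval x (homogeneousComponent i s))
      (aeval_mem_pow_of_isHomogeneous hx (homogeneousComponent_isHomogeneous i s)) := by
  conv_lhs => rw [← sum_homogeneousComponent s]
  rw [map_sum, DFinsupp.finsetSum_apply, Finset.sum_eq_single i]
  · rw [toGr_of_isHomogeneous hx (homogeneousComponent_isHomogeneous i s), DirectSum.of_eq_same]
  · intro j _ hj
    rw [toGr_of_isHomogeneous hx (homogeneousComponent_isHomogeneous j s),
      DirectSum.of_eq_of_ne _ _ _ hj.symm]
  · intro hi
    rw [homogeneousComponent_eq_zero i s (by simpa using hi), map_zero, DirectSum.zero_apply]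

theorem toGr_surjective (hk : Function.Surjective (algebraMap k (A ⧸ I)))
    (hx : Ideal.span (Set.range x) = I) :
    Function.Surjective (toGr k x (mem_of_span_range_eq hx)) := by
  intro y
  induction y using DirectSum.induction_on with
  | zero => exact ⟨0, map_zero _⟩
  | of i y =>
    obtain ⟨a, ha, rfl⟩ := cls_surj I y
    obtain ⟨s, hs, hsa⟩ := exists_isHomogeneous_sub_aeval_mem hk hx ha
    have hmem := aeval_mem_pow_of_isHomogeneous (mem_of_span_range_eq hx) hs
    refine ⟨s, ?_⟩
    rw [toGr_of_isHomogeneous _ hs, (cls_eq_iff I ha hmem).2 hsa]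
  | add y z hy hz =>
    obtain ⟨s, rfl⟩ := hy
    obtain ⟨t, rfl⟩ := hz
    exact ⟨s + t, map_add _ _ _⟩

theorem ker_toGr (hk : Function.Surjective (algebraMap k (A ⧸ I)))
    (hx : Ideal.span (Set.range x) = I) (hI : IsNilpotent I)
    (hker : ∀ s : MvPolynomial σ k, aeval x s = 0 → ∀ i, aeval x (homogeneousComponent i s) = 0) :
    RingHom.ker (toGr k x (mem_of_span_range_eq hx)) = RingHom.ker (aeval x) := by
  ext s
  have hcomp (i : ℕ) : toGr k x (mem_of_span_range_eq hx) s i = 0 ↔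
      aeval x (homogeneousComponent i s) = 0 := by
    rw [toGr_apply, cls_eq_zero_iff]
    refine ⟨fun h => ?_, fun h => h ▸ zero_mem _⟩
    obtain ⟨t, ht, hts⟩ := exists_mem_pow_idealOfVars_aeval_eq hk hx hI h
    have := hker (homogeneousComponent i s - t) (by rw [map_sub, hts, sub_self]) i
    rwa [map_sub, homogeneousComponent_eq_zero_of_mem_pow_idealOfVars ht i.lt_succ_self, sub_zero,
      homogeneousComponent_eq_self (homogeneousComponent_isHomogeneous i s)] at this
  rw [RingHom.mem_ker, RingHom.mem_ker, DFinsupp.ext_iff]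
  refine ⟨fun h => ?_, fun h i => (hcomp i).2 (hker s h i)⟩
  rw [← sum_homogeneousComponent s, map_sum]
  exact Finset.sum_eq_zero fun i _ => (hcomp i).1 (h i)

theorem nonempty_algEquiv_directSum_piece (hk : Function.Surjective (algebraMap k (A ⧸ I)))
    (hx : Ideal.span (Set.range x) = I) (hI : IsNilpotent I)
    (hker : ∀ s : MvPolynomial σ k, aeval x s = 0 → ∀ i, aeval x (homogeneousComponent i s) = 0) :
    Nonempty (A ≃ₐ[k] ⨁ i, Piece I i) :=
  ⟨(Ideal.quotientKerAlgEquivOfSurjective (aeval_surjective hk hx hI)).symm.trans <|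
    (Ideal.quotientEquivAlgOfEq k (ker_toGr hk hx hI hker).symm).trans <|
      Ideal.quotientKerAlgEquivOfSurjective (toGr_surjective hk hx)⟩

end GradedMap

section Dimension

variable {k : Type*} [Field k] {A : Type*} [CommRing A] [Algebra k A] (I : Ideal A)

instance finite_ideal [Module.Finite k A] (J : Ideal A) : Module.Finite k J :=
  .of_injective (J.subtype.restrictScalars k) J.subtype_injective

instance finite_piece [Module.Finite k A] (i : ℕ) : Module.Finite k (Piece I i) :=
  .of_surjective _ (pieceMk_surjective I i)

theorem finrank_piece_add_finrank_pow_succ [Module.Finite k A] (i : ℕ) :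
    Module.finrank k (Piece I i) + Module.finrank k ↥(I ^ (i + 1)) =
      Module.finrank k ↥(I ^ i) := by
  have hle : I ^ (i + 1) ≤ I ^ i := Ideal.pow_le_pow_right (Nat.le_add_right i 1)
  let incl : ↥(I ^ (i + 1)) →ₗ[k] ↥(I ^ i) := (Submodule.inclusion hle).restrictScalars k
  have hker : (pieceMk k I i).ker = incl.range := by
    ext a
    rw [LinearMap.mem_ker, pieceMk_eq_zero_iff]
    exact ⟨fun h => ⟨⟨a, h⟩, rfl⟩, by rintro ⟨b, rfl⟩; exact b.2⟩
  rw [← (pieceMk k I i).finrank_range_add_finrank_ker, hker,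
    LinearMap.range_eq_top.2 (pieceMk_surjective I i), finrank_top,
    LinearMap.finrank_range_of_inj (f := incl) (Submodule.inclusion_injective hle)]

theorem finrank_pow_add_finrank_pow [Module.Finite k A] {d : ℕ} (hd : I ^ (d + 1) = ⊥) {i : ℕ}
    (hi : i ≤ d + 1)
    (hH : ∀ j < i, Module.finrank k (Piece I (d - j)) = Module.finrank k (Piece I j)) :
    Module.finrank k ↥(I ^ i) + Module.finrank k ↥(I ^ (d + 1 - i)) = Module.finrank k A := by
  induction i with
  | zero =>
    rw [tsub_zero, hd, pow_zero, Ideal.one_eq_top]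
    have : Module.finrank k ↥(⊥ : Ideal A) = 0 := Module.finrank_zero_of_subsingleton
    rw [this, add_zero]
    exact (Submodule.topEquiv.restrictScalars k).finrank_eq
  | succ i ih =>
    have hlow := finrank_piece_add_finrank_pow_succ (k := k) I i
    have hhigh := finrank_piece_add_finrank_pow_succ (k := k) I (d - i)
    have hsymm := hH i i.lt_succ_self
    have hprev := ih (by omega) fun j hj => hH j (by omega)
    rw [show d + 1 - i = d - i + 1 by omega] at hprev
    rw [show d + 1 - (i + 1) = d - i by omega]
    omega

theorem pow_eq_bot_iff_finrank_piece_eq_zero [Module.Finite k A] (hI : I ≤ Ideal.jacobson ⊥)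
    {i : ℕ} : I ^ i = ⊥ ↔ Module.finrank k (Piece I i) = 0 := by
  have : IsNoetherianRing A := IsNoetherianRing.of_finite k A
  rw [Module.finrank_zero_iff]
  constructor
  · intro h
    have : Subsingleton ↥(I ^ i) := h ▸ inferInstance
    exact (pieceMk_surjective (k := k) I i).subsingleton
  · intro h
    refine Submodule.eq_bot_of_le_smul_of_le_jacobson_bot I _ (IsNoetherian.noetherian _)
      (fun a ha => ?_) hI
    rw [smul_eq_mul, ← pow_succ']
    exact (pieceMk_eq_zero_iff (k := k) I ⟨a, ha⟩).1 (Subsingleton.elim _ _)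

variable {I}

theorem exists_span_range_eq [Module.Finite k A] (hI : I ≤ Ideal.jacobson ⊥) :
    ∃ x : Fin (Module.finrank k (Piece I 1)) → A, Ideal.span (Set.range x) = I := by
  have : IsNoetherianRing A := IsNoetherianRing.of_finite k A
  let b := Module.finBasis k (Piece I 1)
  choose x hx using fun j => pieceMk_surjective (k := k) I 1 (b j)
  have hxI (j) : (x j : A) ∈ I := Ideal.pow_le_self one_ne_zero (x j).2
  refine ⟨fun j => x j, eq_of_le_sup_sq hI (IsNoetherian.noetherian _)
    (Ideal.span_le.2 (Set.range_subset_iff.2 hxI)) fun a ha => ?_⟩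
  rw [← pow_one I] at ha
  let r := b.repr (pieceMk k I 1 ⟨a, ha⟩)
  have hsq : a - ∑ j, r j • (x j : A) ∈ I ^ 2 := by
    have hzero : pieceMk k I 1 (⟨a, ha⟩ - ∑ j, r j • x j) = 0 := by
      simp only [map_sub, map_sum, map_smul, hx, r, b.sum_repr, sub_self]
    simpa using (pieceMk_eq_zero_iff I _).1 hzero
  rw [← add_sub_cancel (∑ j, r j • (x j : A)) a]
  refine add_mem (Ideal.mem_sup_left (sum_mem fun j _ => ?_)) (Ideal.mem_sup_right hsq)
  rw [Algebra.smul_def]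
  exact Ideal.mul_mem_left _ _ (Ideal.subset_span ⟨j, rfl⟩)

theorem eq_zero_of_aeval_mem_pow_succ {σ : Type*} [Fintype σ] {x : σ → A} {i : ℕ}
    (hk : Function.Surjective (algebraMap k (A ⧸ I))) (hx : Ideal.span (Set.range x) = I)
    (hi : Module.finrank k (Piece I i) = (Fintype.card σ).multichoose i)
    {s : MvPolynomial σ k} (hs : s.IsHomogeneous i) (h : aeval x s ∈ I ^ (i + 1)) : s = 0 := by
  have hmem := mem_of_span_range_eq hx
  let f : homogeneousSubmodule σ k i →ₗ[k] Piece I i :=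
    pieceMk k I i ∘ₗ
      ((aeval x : MvPolynomial σ k →ₐ[k] A).toLinearMap.domRestrict _).codRestrict
        ((I ^ i).restrictScalars k) fun s => aeval_mem_pow_of_isHomogeneous hmem s.2
  have hsurj : Function.Surjective f := by
    intro y
    obtain ⟨a, ha, rfl⟩ := cls_surj I y
    obtain ⟨s, hs, hsa⟩ := exists_isHomogeneous_sub_aeval_mem hk hx ha
    exact ⟨⟨s, hs⟩, ((cls_eq_iff I ha (aeval_mem_pow_of_isHomogeneous hmem hs)).2 hsa).symm⟩
  have : Module.Finite k (Piece I i) := .of_surjective f hsurj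
  have hinj : Function.Injective f :=
    (LinearMap.injective_iff_surjective_of_finrank_eq_finrank
      (finrank_homogeneousSubmodule.trans hi.symm)).2 hsurj
  have hzero : f ⟨s, hs⟩ = 0 := (cls_eq_zero_iff _).2 h
  exact congrArg Subtype.val ((map_eq_zero_iff f hinj).1 hzero)

end Dimension

section Taylor

variable {k : Type*} [CommRing k] {A : Type*} [CommRing A] [Algebra k A] {I : Ideal A}
  {σ : Type*} {x c : σ → A} {s : MvPolynomial σ k} {i : ℕ}

theorem aeval_add_sub_aeval_mem_pow (hx : ∀ j, x j ∈ I) (hc : ∀ j, c j ∈ I ^ 2)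
    (hs : s.IsHomogeneous i) : aeval (x + c) s - aeval x s ∈ I ^ (i + 1) := by
  refine isHomogeneous_induction (P := fun i s => aeval (x + c) s - aeval x s ∈ I ^ (i + 1))
    ?_ ?_ ?_ ?_ hs
  · simp only [map_zero, sub_self, zero_mem, implies_true]
  · intro i s t _ _ hs ht
    simpa only [map_add, add_sub_add_comm] using add_mem hs ht
  · simp only [algHom_C, sub_self, zero_mem, implies_true]
  · intro i j s hs ih
    have hsplit : aeval (x + c) (X j * s) - aeval x (X j * s) =
        (aeval (x + c) s - aeval x s) * (x + c) j + aeval x s * c j := by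
      simp only [map_mul, aeval_X, Pi.add_apply]
      ring
    rw [hsplit]
    exact add_mem
      (Ideal.mul_mem_mul ih (add_mem (hx j) (Ideal.pow_le_self two_ne_zero (hc j))))
      (mul_mem_pow I (i := i) (aeval_mem_pow_of_isHomogeneous hx hs) (hc j))

theorem aeval_add_sub_aeval_sub_sum_pderiv_mem_pow [Fintype σ] (hx : ∀ j, x j ∈ I)
    (hc : ∀ j, c j ∈ I ^ 2) (hs : s.IsHomogeneous i) :
    aeval (x + c) s - aeval x s - ∑ j, c j * aeval x (pderiv j s) ∈ I ^ (i + 2) := by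
  classical
  refine isHomogeneous_induction (P := fun i s =>
    aeval (x + c) s - aeval x s - ∑ j, c j * aeval x (pderiv j s) ∈ I ^ (i + 2)) ?_ ?_ ?_ ?_ hs
  · simp only [map_zero, sub_self, mul_zero, Finset.sum_const_zero, zero_mem, implies_true]
  · intro i s t _ _ hs ht
    simpa only [map_add, mul_add, Finset.sum_add_distrib, add_sub_add_comm] using add_mem hs ht
  · simp only [algHom_C, pderiv_C, map_zero, sub_self, mul_zero, Finset.sum_const_zero, zero_mem,
      implies_true]
  · intro i j s hs ih
    have hleibniz : ∑ l, c l * aeval x (pderiv l (X j * s)) =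
        x j * ∑ l, c l * aeval x (pderiv l s) + c j * aeval x s := by
      simp only [Derivation.leibniz, pderiv_X, smul_eq_mul, map_add, map_mul, aeval_X, mul_add,
        Finset.sum_add_distrib, Finset.mul_sum, Pi.single_apply, apply_ite (aeval x),
        map_zero, mul_ite, mul_one, mul_zero, Finset.sum_ite_eq, Finset.mem_univ, if_true]
      congr 1
      exact Finset.sum_congr rfl fun l _ => by ring
    have hsplit : aeval (x + c) (X j * s) - aeval x (X j * s) -
          ∑ l, c l * aeval x (pderiv l (X j * s)) =
        (aeval (x + c) s - aeval x s - ∑ l, c l * aeval x (pderiv l s)) * x j +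
          (aeval (x + c) s - aeval x s) * c j := by
      rw [hleibniz]
      simp only [map_mul, aeval_X, Pi.add_apply]
      ring
    rw [hsplit]
    exact add_mem (Ideal.mul_mem_mul ih (hx j))
      (mul_mem_pow I (aeval_add_sub_aeval_mem_pow hx hc hs) (hc j))

end Taylor

section Pairing

variable {k : Type*} [CommRing k] {A : Type*} [CommRing A] [Algebra k A] {I : Ideal A}
  {σ : Type*} {x : σ → A} {s : MvPolynomial σ k} {φ : A →ₗ[k] k} {d e i : ℕ}

/-- The bilinear form `(a, b) ↦ φ (a * b)` on an algebra. Its nondegeneracy is how Gorenstein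
duality is encoded below. -/
def mulForm (φ : A →ₗ[k] k) : LinearMap.BilinForm k A := (LinearMap.mul k A).compr₂ φ

theorem mem_pow_idealOfVars_of_aeval_eq_zero (hx : ∀ j, x j ∈ I)
    (hinj : ∀ i < e, ∀ s : MvPolynomial σ k,
      s.IsHomogeneous i → aeval x s ∈ I ^ (i + 1) → s = 0)
    (hs : aeval x s = 0) : s ∈ idealOfVars σ k ^ e := by
  suffices h : ∀ i ≤ e, s ∈ idealOfVars σ k ^ i from h e le_rfl
  intro i hi
  induction i with
  | zero => exact mem_pow_zero _ _
  | succ i ih =>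
    have hsub := sub_homogeneousComponent_mem_pow_idealOfVars (ih (by omega))
    have hmem : aeval x (homogeneousComponent i s) ∈ I ^ (i + 1) := by
      rw [← neg_mem_iff, ← zero_sub, ← hs, ← map_sub]
      exact aeval_mem_pow hx hsub
    rwa [hinj i hi _ (homogeneousComponent_isHomogeneous i s) hmem, sub_zero] at hsub

theorem apply_aeval_eq_apply_aeval_homogeneousComponent (hd : I ^ (d + 1) = ⊥)
    (hx : ∀ j, x j ∈ I)
    (hzero : ∀ j, e ≤ j → j < d → ∀ s : MvPolynomial σ k, s.IsHomogeneous j → φ (aeval x s) = 0)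
    (hs : s ∈ idealOfVars σ k ^ e) :
    φ (aeval x s) = φ (aeval x (homogeneousComponent d s)) := by
  conv_lhs => rw [← sum_homogeneousComponent s, map_sum, map_sum]
  refine Finset.sum_eq_single d (fun j _ hj => ?_) fun hds => ?_
  · have hj' := homogeneousComponent_isHomogeneous j s
    obtain hje | hje := lt_or_ge j e
    · rw [homogeneousComponent_eq_zero_of_mem_pow_idealOfVars hs hje, map_zero, map_zero]
    obtain hjd | hjd := hj.lt_or_gt
    · exact hzero j hje hjd _ hj'
    · have hmem := Ideal.pow_le_pow_right hjd (aeval_mem_pow_of_isHomogeneous hx hj')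
      rw [hd, Ideal.mem_bot] at hmem
      rw [hmem, map_zero]
  · rw [homogeneousComponent_eq_zero d s (by simpa using hds), map_zero, map_zero]

/-- Both `s_i * t` and `s * t_{d - i}` have the component `s_i * t_{d - i}` in degree `d`, the only
degree seen by `φ`. -/
theorem aeval_homogeneousComponent_eq_zero (hφ : (mulForm φ).Nondegenerate)
    (hd : I ^ (d + 1) = ⊥) (hx : ∀ j, x j ∈ I)
    (hsurj : Function.Surjective (aeval x : MvPolynomial σ k →ₐ[k] A))
    (hinj : ∀ i < e, ∀ s : MvPolynomial σ k,
      s.IsHomogeneous i → aeval x s ∈ I ^ (i + 1) → s = 0)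
    (hzero : ∀ j, e ≤ j → j < d → ∀ s : MvPolynomial σ k, s.IsHomogeneous j → φ (aeval x s) = 0)
    (hs : aeval x s = 0) (i : ℕ) : aeval x (homogeneousComponent i s) = 0 := by
  have hsi := homogeneousComponent_isHomogeneous i s
  obtain hid | hid := lt_or_ge d i
  · have hmem := Ideal.pow_le_pow_right hid (aeval_mem_pow_of_isHomogeneous hx hsi)
    rwa [hd, Ideal.mem_bot] at hmem
  have hse := mem_pow_idealOfVars_of_aeval_eq_zero hx hinj hs
  have htop {u : MvPolynomial σ k} (hu : u ∈ idealOfVars σ k ^ e) :=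
    apply_aeval_eq_apply_aeval_homogeneousComponent hd hx hzero hu
  refine hφ.1 _ fun a => ?_
  obtain ⟨t, rfl⟩ := hsurj a
  have hti := homogeneousComponent_isHomogeneous (d - i) t
  have hcomp : homogeneousComponent d (homogeneousComponent i s * t) =
      homogeneousComponent d (homogeneousComponent (d - i) t * s) := by
    have hst := homogeneousComponent_add_mul hsi t (d - i)
    have hts := homogeneousComponent_add_mul hti s i
    rw [Nat.add_sub_of_le hid] at hst
    rw [Nat.sub_add_cancel hid] at hts
    rw [hst, hts, mul_comm]
  calc φ (aeval x (homogeneousComponent i s) * aeval x t)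
    _ = φ (aeval x (homogeneousComponent i s * t)) := by rw [map_mul (aeval x)]
    _ = φ (aeval x (homogeneousComponent d (homogeneousComponent i s * t))) :=
      htop (Ideal.mul_mem_right _ _ (homogeneousComponent_mem_pow_idealOfVars hse i))
    _ = φ (aeval x (homogeneousComponent (d - i) t * s)) := by
      rw [hcomp, ← htop (Ideal.mul_mem_left _ _ hse)]
    _ = 0 := by rw [map_mul (aeval x), hs, mul_zero, map_zero]

end Pairing

section Duality

variable {k : Type*} [Field k] {A : Type*} [CommRing A] [Algebra k A] {I : Ideal A}
  {σ : Type*} {x : σ → A} {φ : A →ₗ[k] k} {d e i : ℕ}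

theorem mem_pow_of_forall_apply_mul_eq_zero [Module.Finite k A] (hφ : (mulForm φ).Nondegenerate)
    (hd : I ^ (d + 1) = ⊥) (hi : i ≤ d + 1)
    (hH : ∀ j < i, Module.finrank k (Piece I (d - j)) = Module.finrank k (Piece I j))
    {c : A} (hc : ∀ b ∈ I ^ i, φ (b * c) = 0) : c ∈ I ^ (d + 1 - i) := by
  let W := (I ^ i).restrictScalars k
  let V := (I ^ (d + 1 - i)).restrictScalars k
  have hle : V ≤ (mulForm φ).orthogonal W := by
    intro v hv b hb
    have hbv : b * v ∈ I ^ (d + 1) := Nat.add_sub_of_le hi ▸ mul_mem_pow I hb hv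
    rw [hd, Ideal.mem_bot] at hbv
    exact (congrArg φ hbv).trans (map_zero φ)
  have hfinrank : Module.finrank k V = Module.finrank k ((mulForm φ).orthogonal W) := by
    rw [LinearMap.BilinForm.finrank_orthogonal hφ]
    exact Nat.eq_sub_of_add_eq' (finrank_pow_add_finrank_pow I hd hi hH)
  have hmem : c ∈ (mulForm φ).orthogonal W := hc
  rwa [← Submodule.eq_of_le_of_finrank_eq hle hfinrank] at hmem

theorem exists_mem_pow_forall_apply_mul_aeval_eq [Module.Finite k A]
    (hφ : (mulForm φ).Nondegenerate) (hd : I ^ (d + 1) = ⊥) (hi : i ≤ d)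
    (hH : ∀ j ≤ i, Module.finrank k (Piece I (d - j)) = Module.finrank k (Piece I j))
    (hinj : ∀ s : MvPolynomial σ k, s.IsHomogeneous i → aeval x s ∈ I ^ (i + 1) → s = 0)
    (g : homogeneousSubmodule σ k i →ₗ[k] k) :
    ∃ c ∈ I ^ (d - i), ∀ s : homogeneousSubmodule σ k i, φ (c * aeval x s.1) = g s := by
  let q : A →ₗ[k] A ⧸ (I ^ (i + 1)).restrictScalars k := Submodule.mkQ _
  let f : homogeneousSubmodule σ k i →ₗ[k] A ⧸ (I ^ (i + 1)).restrictScalars k :=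
    q ∘ₗ (aeval x : MvPolynomial σ k →ₐ[k] A).toLinearMap.domRestrict _
  have hf : f.ker = ⊥ := LinearMap.ker_eq_bot'.2 fun s hs =>
    Subtype.ext (hinj s s.2 ((Submodule.Quotient.mk_eq_zero _).1 hs))
  obtain ⟨r, hr⟩ := f.exists_leftInverse_of_injective hf
  let c := ((mulForm φ).toDual hφ).symm (g ∘ₗ r ∘ₗ q)
  have hc (a : A) : φ (c * a) = g (r (q a)) :=
    LinearMap.BilinForm.apply_toDual_symm_apply (hB := hφ) (g ∘ₗ r ∘ₗ q) a
  refine ⟨c, ?_, fun s => (hc _).trans (congrArg g (LinearMap.congr_fun hr s))⟩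
  rw [← Nat.add_sub_add_right d 1 i]
  refine mem_pow_of_forall_apply_mul_eq_zero hφ hd (by omega) (fun j hj => hH j (by omega))
    fun b hb => ?_
  have hqb : q b = 0 := (Submodule.Quotient.mk_eq_zero _).2 hb
  rw [mul_comm, hc, hqb, map_zero, map_zero]

/-- By Euler's identity, `c j` has to represent `-(e + 1)⁻¹ • φ (x j * ·)` on forms of degree `e`
for the first-order Taylor term to cancel `φ` on forms of degree `e + 1`. -/
theorem exists_forall_apply_aeval_add_eq_zero [Module.Finite k A] [Finite σ]
    (hφ : (mulForm φ).Nondegenerate) (he : ((e + 1 : ℕ) : k) ≠ 0) (hd : I ^ (e + 3) = ⊥)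
    (hH : ∀ j ≤ e, Module.finrank k (Piece I (e + 2 - j)) = Module.finrank k (Piece I j))
    (hx : ∀ j, x j ∈ I)
    (hinj : ∀ s : MvPolynomial σ k, s.IsHomogeneous e → aeval x s ∈ I ^ (e + 1) → s = 0) :
    ∃ c : σ → A, (∀ j, c j ∈ I ^ 2) ∧
      ∀ s : MvPolynomial σ k, s.IsHomogeneous (e + 1) → φ (aeval (x + c) s) = 0 := by
  have := Fintype.ofFinite σ
  let g (j : σ) : homogeneousSubmodule σ k e →ₗ[k] k :=
    -((e + 1 : ℕ) : k)⁻¹ • (mulForm φ (x j) ∘ₗ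
      (aeval x : MvPolynomial σ k →ₐ[k] A).toLinearMap.domRestrict _)
  choose c hc2 hc using fun j =>
    exists_mem_pow_forall_apply_mul_aeval_eq hφ hd (Nat.le_add_right e 2) hH hinj (g j)
  rw [Nat.add_sub_cancel_left] at hc2
  refine ⟨c, hc2, fun s hs => ?_⟩
  have htaylor : aeval (x + c) s = aeval x s + ∑ j, c j * aeval x (pderiv j s) := by
    have := aeval_add_sub_aeval_sub_sum_pderiv_mem_pow hx hc2 hs
    rw [add_assoc, hd, Ideal.mem_bot] at this
    rw [← sub_eq_zero, ← this]
    ring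
  have heuler : ∑ j, x j * aeval x (pderiv j s) = (e + 1) • aeval x s := by
    simpa only [map_sum, map_mul, aeval_X, map_nsmul] using
      congrArg (aeval x) hs.sum_X_mul_pderiv
  have hrep (j : σ) : φ (c j * aeval x (pderiv j s)) =
      -((e + 1 : ℕ) : k)⁻¹ * φ (x j * aeval x (pderiv j s)) := hc j ⟨pderiv j s, hs.pderiv⟩
  rw [htaylor, map_add, map_sum]
  simp only [hrep]
  rw [← Finset.mul_sum, ← map_sum, heuler, map_nsmul, nsmul_eq_mul, neg_mul,
    inv_mul_cancel_left₀ he, add_neg_cancel]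

theorem nonempty_algEquiv_directSum_piece_of_apply_aeval_eq_zero [Fintype σ]
    (hk : Function.Surjective (algebraMap k (A ⧸ I))) (hx : Ideal.span (Set.range x) = I)
    (hφ : (mulForm φ).Nondegenerate) (hd : I ^ (d + 1) = ⊥)
    (hfree : ∀ i < e, Module.finrank k (Piece I i) = (Fintype.card σ).multichoose i)
    (hzero : ∀ j, e ≤ j → j < d → ∀ s : MvPolynomial σ k, s.IsHomogeneous j → φ (aeval x s) = 0) :
    Nonempty (A ≃ₐ[k] ⨁ i, Piece I i) :=
  have hI : IsNilpotent I := ⟨d + 1, hd⟩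
  nonempty_algEquiv_directSum_piece hk hx hI fun _ =>
    aeval_homogeneousComponent_eq_zero hφ hd (mem_of_span_range_eq hx) (aeval_surjective hk hx hI)
      (fun i hi _ => eq_zero_of_aeval_mem_pow_succ hk hx (hfree i hi)) hzero

theorem nonempty_algEquiv_directSum_piece_of_finrank_eq_multichoose [Module.Finite k A]
    (hk : Function.Surjective (algebraMap k (A ⧸ I))) (hI : I ≤ Ideal.jacobson ⊥)
    (hφ : (mulForm φ).Nondegenerate) (hd : I ^ (d + 1) = ⊥)
    (hfree : ∀ i < d,
      Module.finrank k (Piece I i) = (Module.finrank k (Piece I 1)).multichoose i) :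
    Nonempty (A ≃ₐ[k] ⨁ i, Piece I i) := by
  obtain ⟨x, hx⟩ := exists_span_range_eq (k := k) hI
  refine nonempty_algEquiv_directSum_piece_of_apply_aeval_eq_zero hk hx hφ hd (e := d) ?_ ?_
  · simpa only [Fintype.card_fin] using hfree
  · exact fun j hdj hjd => absurd hjd hdj.not_gt

theorem nonempty_algEquiv_directSum_piece_of_finrank_eq_multichoose_of_symm [Module.Finite k A]
    (hk : Function.Surjective (algebraMap k (A ⧸ I))) (hI : I ≤ Ideal.jacobson ⊥)
    (hφ : (mulForm φ).Nondegenerate) (he : ((e + 1 : ℕ) : k) ≠ 0) (hd : I ^ (e + 3) = ⊥)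
    (hfree : ∀ i ≤ e,
      Module.finrank k (Piece I i) = (Module.finrank k (Piece I 1)).multichoose i)
    (hH : ∀ i ≤ e, Module.finrank k (Piece I (e + 2 - i)) = Module.finrank k (Piece I i)) :
    Nonempty (A ≃ₐ[k] ⨁ i, Piece I i) := by
  have : IsNoetherianRing A := IsNoetherianRing.of_finite k A
  obtain ⟨x, hx⟩ := exists_span_range_eq (k := k) hI
  have hfree' (i : ℕ) (hi : i ≤ e) : Module.finrank k (Piece I i) =
      (Fintype.card (Fin (Module.finrank k (Piece I 1)))).multichoose i := by
    rw [Fintype.card_fin, hfree i hi]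
  obtain ⟨c, hc, hzero⟩ := exists_forall_apply_aeval_add_eq_zero hφ he hd hH
    (mem_of_span_range_eq hx) fun _ => eq_zero_of_aeval_mem_pow_succ hk hx (hfree' e le_rfl)
  have hxc := span_range_add_eq hI (IsNoetherian.noetherian I) hx hc
  refine nonempty_algEquiv_directSum_piece_of_apply_aeval_eq_zero hk hxc hφ hd (e := e + 1)
    (fun i hi => hfree' i (Nat.lt_succ_iff.1 hi)) fun j hej hjd => ?_
  obtain rfl : j = e + 1 := by omega
  exact hzero

end Duality

section Local

variable {k : Type*} [Field k] {A : Type*} [CommRing A] [IsLocalRing A] [Algebra k A] {d : ℕ}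

theorem socle_le_of_ne_bot (hA : IsArtinGorenstein A) {J : Ideal A} (hJ : J ≠ ⊥) :
    socle A ≤ J := by
  have := hA.1
  obtain ⟨N, hN, hNJ⟩ := (eq_bot_or_exists_atom_le J).resolve_left hJ
  have : IsSimpleModule A N := isSimpleModule_iff_isAtom.2 hN
  have hann : Module.annihilator A N = maximalIdeal A :=
    eq_maximalIdeal IsSimpleModule.annihilator_isMaximal
  have hle : N ≤ socle A := fun a ha => Module.mem_annihilator.2 fun y => Subtype.ext <| by
    have hy : y.1 ∈ Module.annihilator A N := by rw [hann]; exact y.2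
    simpa only [smul_eq_mul, mul_comm, SetLike.val_smul, ZeroMemClass.coe_zero] using
      congrArg Subtype.val (Module.mem_annihilator.1 hy ⟨a, ha⟩)
  have hsocle : IsAtom (socle A) := isSimpleModule_iff_isAtom.1 hA.2
  exact (hsocle.le_iff_eq hN.1).1 hle ▸ hNJ

theorem IsArtinGorenstein.exists_nondegenerate_mulForm (hA : IsArtinGorenstein A) :
    ∃ φ : A →ₗ[k] k, (mulForm φ).Nondegenerate := by
  have hsocle : socle A ≠ ⊥ := (isSimpleModule_iff_isAtom.1 hA.2).1
  obtain ⟨z, hz, hz0⟩ := Submodule.exists_mem_ne_zero_of_ne_bot hsocle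
  obtain ⟨φ, hφ⟩ := Module.Projective.exists_dual_ne_zero k hz0
  have hleft (c : A) (hc : ∀ a, φ (c * a) = 0) : c = 0 := by
    by_contra hc0
    have hspan : Ideal.span {c} ≠ ⊥ := mt Ideal.span_singleton_eq_bot.1 hc0
    obtain ⟨a, rfl⟩ := Ideal.mem_span_singleton.1 (socle_le_of_ne_bot hA hspan hz)
    exact hφ (hc a)
  exact ⟨φ, hleft, fun c hc => hleft c fun a => mul_comm a c ▸ hc a⟩

theorem finite_of_isArtinianRing [IsArtinianRing A]
    (hk : Function.Surjective (algebraMap k (ResidueField A))) : Module.Finite k A :=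
  finite_of_isNilpotent hk (IsNoetherian.noetherian (maximalIdeal A))
    (jacobson_eq_maximalIdeal (⊥ : Ideal A) bot_ne_top ▸ IsArtinianRing.isNilpotent_jacobson_bot)

theorem isSocleDegree_iff :
    IsSocleDegree A d ↔ maximalIdeal A ^ d ≠ ⊥ ∧ maximalIdeal A ^ (d + 1) = ⊥ := by
  refine ⟨fun h => ⟨h.1, not_not.1 fun hd => d.lt_irrefl (h.2 hd)⟩, fun h => ⟨h.1, fun i hi => ?_⟩⟩
  by_contra! hdi
  exact hi (eq_bot_iff.2 (h.2 ▸ Ideal.pow_le_pow_right hdi))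

theorem natCast_ne_zero_of_ringChar_ne {R : Type*} [NonAssocRing R] [Nontrivial R] {p : ℕ}
    (hp : p.Prime) (h : ringChar R ≠ p) : (p : R) ≠ 0 := fun hzero =>
  ((Nat.dvd_prime hp).1 (ringChar.dvd hzero)).elim CharP.ringChar_ne_one h

theorem monotone_multichoose {n : ℕ} (hn : n ≠ 0) : Monotone n.multichoose := by
  obtain ⟨n, rfl⟩ := Nat.exists_eq_succ_of_ne_zero hn
  exact monotone_nat_of_le_succ fun i => Nat.multichoose_succ_succ n i ▸ Nat.le_add_left _ _

section Finite

variable [Module.Finite k A]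

theorem hilbertFunction_eq_zero_iff {i : ℕ} :
    hilbertFunction k A i = 0 ↔ maximalIdeal A ^ i = ⊥ :=
  (pow_eq_bot_iff_finrank_piece_eq_zero _ (maximalIdeal_le_jacobson _)).symm

variable (k) in
theorem isSocleDegree_iff_hilbertFunction :
    IsSocleDegree A d ↔ hilbertFunction k A d ≠ 0 ∧ hilbertFunction k A (d + 1) = 0 := by
  rw [isSocleDegree_iff, Ne, Ne, hilbertFunction_eq_zero_iff, hilbertFunction_eq_zero_iff]

theorem IsSocleDegree.hilbertFunction_one_ne_zero (hd : IsSocleDegree A d) (hd0 : d ≠ 0) :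
    hilbertFunction k A 1 ≠ 0 := by
  rw [Ne, hilbertFunction_eq_zero_iff, pow_one]
  intro h
  exact hd.1 (by rw [h, ← Ideal.zero_eq_bot, zero_pow hd0])

theorem isCompressed_iff :
    IsCompressed k A d ↔ IsSocleDegree A d ∧ ∀ i, 2 * i ≤ d →
      hilbertFunction k A i = (hilbertFunction k A 1).multichoose i ∧
      hilbertFunction k A (d - i) = (hilbertFunction k A 1).multichoose i := by
  refine and_congr_right fun hd => ?_
  have hmono {i j : ℕ} (hij : i ≤ j) (hj : j ≤ d) :
      (hilbertFunction k A 1).multichoose i ≤ (hilbertFunction k A 1).multichoose j := by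
    obtain rfl | hd0 := eq_or_ne d 0
    · rw [Nat.le_zero.1 hj, Nat.le_zero.1 (hij.trans hj)]
    · exact monotone_multichoose (hd.hilbertFunction_one_ne_zero hd0) hij
  constructor
  · intro h i hi
    have hle := hmono (i := i) (j := d - i) (by omega) (by omega)
    rw [h i (by omega), h (d - i) (by omega), Nat.sub_sub_self (by omega)]
    exact ⟨min_eq_left hle, min_eq_right hle⟩
  · intro h i hi
    obtain hid | hid : 2 * i ≤ d ∨ 2 * (d - i) ≤ d := by omega
    · rw [(h i hid).1, min_eq_left (hmono (by omega) (by omega))]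
    · have := (h (d - i) hid).2
      rw [Nat.sub_sub_self hi] at this
      rw [this, min_eq_right (hmono (by omega) hi)]

theorem IsCompressed.isCanonicallyGraded (h : IsCompressed k A d) (hd : d ≤ 4)
    (hchar : 2 ≤ d → ((d - 1 : ℕ) : k) ≠ 0)
    (hk : Function.Surjective (algebraMap k (ResidueField A))) (hA : IsArtinGorenstein A) :
    IsCanonicallyGraded k A := by
  obtain ⟨φ, hφ⟩ := hA.exists_nondegenerate_mulForm (k := k)
  obtain ⟨hsocle, hH⟩ := isCompressed_iff.1 h
  have hbot := (isSocleDegree_iff.1 hsocle).2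
  have hm : maximalIdeal A ≤ Ideal.jacobson ⊥ := maximalIdeal_le_jacobson _
  obtain hd2 | ⟨e, rfl⟩ : d < 2 ∨ ∃ e, d = e + 2 := by
    obtain hd2 | hd2 := lt_or_ge d 2
    exacts [.inl hd2, .inr ⟨d - 2, by omega⟩]
  · exact nonempty_algEquiv_directSum_piece_of_finrank_eq_multichoose hk hm hφ hbot
      fun i hi => (hH i (by omega)).1
  · exact nonempty_algEquiv_directSum_piece_of_finrank_eq_multichoose_of_symm hk hm hφ
      (hchar (by omega)) hbot (fun i hi => (hH i (by omega)).1)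
      fun i hi => (hH i (by omega)).2.trans (hH i (by omega)).1.symm

theorem isCompressed_three_of_hilbertFunction {n : ℕ}
    (hH : ∀ i, hilbertFunction k A i = [1, n, n, 1].getD i 0) : IsCompressed k A 3 := by
  refine isCompressed_iff.2 ⟨(isSocleDegree_iff_hilbertFunction k).2 ?_, fun i hi => ?_⟩
  · simp [hH]
  · obtain rfl | rfl : i = 0 ∨ i = 1 := by omega
    all_goals simp [hH]

theorem isCompressed_four_of_hilbertFunction {n : ℕ}
    (hH : ∀ i, hilbertFunction k A i = [1, n, (n + 1).choose 2, n, 1].getD i 0) :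
    IsCompressed k A 4 := by
  refine isCompressed_iff.2 ⟨(isSocleDegree_iff_hilbertFunction k).2 ?_, fun i hi => ?_⟩
  · simp [hH]
  · obtain rfl | rfl | rfl : i = 0 ∨ i = 1 ∨ i = 2 := by omega
    all_goals simp [hH, Nat.multichoose_eq]

end Finite

end Local

end AssocGr

end

theorem mainTheorem1_general {k : Type*} [Field k] {A : Type*} [CommRing A] [IsLocalRing A]
    [Algebra k A] (hk2 : AssocGr.IsSocleDegree A 3 → ringChar k ≠ 2)
    (hk3 : AssocGr.IsSocleDegree A 4 → ringChar k ≠ 3)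
    (hres : Function.Surjective (algebraMap k (IsLocalRing.ResidueField A)))
    (hA : AssocGr.IsArtinGorenstein A) :
    (∀ d : ℕ, d ≤ 4 → AssocGr.IsCompressed k A d → AssocGr.IsCanonicallyGraded k A) ∧
    (∀ n : ℕ, (∀ i, AssocGr.hilbertFunction k A i = [1, n, n, 1].getD i 0) →
      AssocGr.IsCompressed k A 3 ∧ AssocGr.IsCanonicallyGraded k A) ∧
    (∀ n : ℕ, (∀ i, AssocGr.hilbertFunction k A i = [1, n, (n + 1).choose 2, n, 1].getD i 0) →
      AssocGr.IsCompressed k A 4 ∧ AssocGr.IsCanonicallyGraded k A) := by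
  have := hA.1
  have := AssocGr.finite_of_isArtinianRing hres
  have hgraded (d : ℕ) (hd : d ≤ 4) (h : AssocGr.IsCompressed k A d) :
      AssocGr.IsCanonicallyGraded k A := by
    refine h.isCanonicallyGraded hd (fun hd2 => ?_) hres hA
    obtain rfl | rfl | rfl : d = 2 ∨ d = 3 ∨ d = 4 := by omega
    · simp
    · exact_mod_cast Ring.two_ne_zero (hk2 h.1)
    · exact AssocGr.natCast_ne_zero_of_ringChar_ne Nat.prime_three (hk3 h.1)
  refine ⟨hgraded, fun n hn => ?_, fun n hn => ?_⟩
  · have h := AssocGr.isCompressed_three_of_hilbertFunction hn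
    exact ⟨h, hgraded 3 (by omega) h⟩
  · have h := AssocGr.isCompressed_four_of_hilbertFunction hn
    exact ⟨h, hgraded 4 le_rfl h⟩

theorem mainTheorem1 {k : Type*} [Field k] (hk2 : ringChar k ≠ 2) (hk3 : ringChar k ≠ 3)
    {A : Type*} [CommRing A] [IsLocalRing A] [Algebra k A]
    (hres : Function.Bijective (algebraMap k (IsLocalRing.ResidueField A)))
    (hA : AssocGr.IsArtinGorenstein A) :
    (∀ d : ℕ, d ≤ 4 → AssocGr.IsCompressed k A d → AssocGr.IsCanonicallyGraded k A) ∧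
    (∀ n : ℕ, (∀ i, AssocGr.hilbertFunction k A i = [1, n, n, 1].getD i 0) →
      AssocGr.IsCompressed k A 3 ∧ AssocGr.IsCanonicallyGraded k A) ∧
    (∀ n : ℕ, (∀ i, AssocGr.hilbertFunction k A i = [1, n, (n + 1).choose 2, n, 1].getD i 0) →
      AssocGr.IsCompressed k A 4 ∧ AssocGr.IsCanonicallyGraded k A) :=
  mainTheorem1_general (fun _ => hk2) (fun _ => hk3) hres.2 hA
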